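/- A binary linear code $C\subseteq\mathbb{F}_2^n$ of dimension $s$ is called an $[n,s,k]_P$ code ($k$-PIR code) if it admits a generator matrix $G\in\mathbb{F}_2^{s\times n}$, with columns $G^1,\dots,G^n$, such that for every $1\le i\le s$ there are $k$ mutually disjoint sets $R_{1},\dots,R_{k}\subseteq\{1,\dots,n\}$ with $\sum_{h\in R_{j}}G^h=e_i$ for all $1\le j\le k$, where $e_i$ is the $i$th unit vector of $\mathbb{F}_2^s$. Let $P(s,k)$ denote the smallest $n$ for which an $[n,s,k]_P$ code exists. Then $P(5,2)=6$, $P(5,4)=10$, $P(5,6)=14$, $P(5,8)=18$, $P(5,10)=22$, $P(5,12)=25$, $P(5,14)=28$, $P(5,16)=31$, and for all even $k>16$ we have $$P(5,k)=P(5,k-16\tau)+31\tau,\qquad\text{where } \tau=\lfloor (k-1)/16\rfloor .$$ -/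

import Mathlib

namespace PIR

/-- `G` is a generator matrix of the binary linear code `C` of length `n`: its rows form a basis
of `C`, so `C` has dimension `s`. -/
def IsGeneratorMatrix {n s : ℕ} (C : Submodule (ZMod 2) (Fin n → ZMod 2))
    (G : Matrix (Fin s) (Fin n) (ZMod 2)) : Prop :=
  LinearIndependent (ZMod 2) G.row ∧ Submodule.span (ZMod 2) (Set.range G.row) = C

/-- `R` is a recovery set for the `i`-th information bit: the columns of `G` indexed by `R` sum
to the `i`-th unit vector. -/
def IsRecoverySet {n s : ℕ} (G : Matrix (Fin s) (Fin n) (ZMod 2)) (i : Fin s)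
    (R : Finset (Fin n)) : Prop :=
  ∑ h ∈ R, G.col h = Pi.single i 1

/-- `C` is an `[n,s,k]_P` code: an `[n,s]` binary linear code admitting a generator matrix for
which every information bit has `k` mutually disjoint recovery sets. -/
def IsPIRCode (n s k : ℕ) (C : Submodule (ZMod 2) (Fin n → ZMod 2)) : Prop :=
  ∃ G : Matrix (Fin s) (Fin n) (ZMod 2), IsGeneratorMatrix C G ∧
    ∀ i : Fin s, ∃ R : Fin k → Finset (Fin n),
      (∀ j j', j ≠ j' → Disjoint (R j) (R j')) ∧ ∀ j, IsRecoverySet G i (R j)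

/-- `P s k` is the smallest length `n` of an `[n,s,k]_P` code. -/
noncomputable def P (s k : ℕ) : ℕ :=
  sInf {n : ℕ | ∃ C : Submodule (ZMod 2) (Fin n → ZMod 2), IsPIRCode n s k C}

end PIR

namespace PIR

/-! Upper bounds come from explicit codes for k = 2, 4, ..., 16. Appending all 31 nonzero vectors
raises n by 31 and k by 16.

For the lower bound let k be even. The columns may be assumed nonzero with sum zero, so every
nonzero codeword v has even weight at least k. The excesses `δ v = (wt d v - k) / 2` form a multiset
of vectors in the dual space, of size D = (16n - 31k)/2. Double counting gives `mass δ q = 4 * F q`,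
where F q = n + `mult d q` - 2k for q ≠ 0: all weights of this dual multiset are divisible by four.
The simplex extension preserves D. One below the claimed length, D is 9, 10, 11, 12, 13, 6 for k ≡
2, 4, 6, 8, 10, 12 mod 16, and negative, hence impossible, for k ≡ 14, 0.

The other cases need more than the minimum weight. A subadditive function on the column space bounds
any packing of recovery sets; applied to `cover` this yields δ v ≤ F e_i whenever v_i = 1
(`PIRFamily.recovery`), and a version modulo a vector q (`PIRFamily.recovery_quotient`). The second
moment of F, together with integrality, forces repeated vectors in δ. A repeated p with p_i = 1
makes F e_i at least two, and the part of δ orthogonal to e_i is then a small multiset with even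
weights. This settles D = 6 and 9 at once; for 10 ≤ D ≤ 13 the two parts of δ, on and off that
hyperplane, are compared by second moments over the orthogonal complement of p (`sum_sq_outer_ge`).
-/

/-- The space of columns of a generator matrix with five rows. -/
abbrev Vec : Type := Fin 5 → ZMod 2

/-! ### Characters and counting -/

/-- The additive character of `Vec` attached to `v`, with values in `{1, -1}`. -/
def chi (v q : Vec) : ℤ := if v ⬝ᵥ q = 1 then -1 else 1

/-- The indicator function of `v ⬝ᵥ q = 1`. -/
def ind (v q : Vec) : ℤ := if v ⬝ᵥ q = 1 then 1 else 0

theorem zmod_two_cases (a : ZMod 2) : a = 0 ∨ a = 1 := by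
  revert a; decide

theorem two_mul_ind (v q : Vec) : 2 * ind v q = 1 - chi v q := by
  unfold ind chi; split_ifs <;> norm_num

theorem ind_comm (v q : Vec) : ind v q = ind q v := by
  unfold ind; rw [dotProduct_comm]

theorem chi_add (v w q : Vec) : chi (v + w) q = chi v q * chi w q := by
  unfold chi
  rw [add_dotProduct]
  rcases zmod_two_cases (v ⬝ᵥ q) with h | h <;> rcases zmod_two_cases (w ⬝ᵥ q) with h' | h' <;>
    rw [h, h'] <;> decide

theorem chi_add_right (v q r : Vec) : chi v (q + r) = chi v q * chi v r := by
  have := chi_add q r v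
  unfold chi at this ⊢
  simpa [dotProduct_comm] using this

theorem chi_zero (q : Vec) : chi 0 q = 1 := by simp [chi]

theorem add_self_vec (v : Vec) : v + v = 0 := by
  funext i; exact CharTwo.add_self_eq_zero (v i)

theorem add_eq_zero_iff_vec (v w : Vec) : v + w = 0 ↔ v = w := by
  constructor
  · intro h
    calc v = v + (w + w) := by rw [add_self_vec, add_zero]
      _ = w := by rw [← add_assoc, h, zero_add]
  · rintro rfl; exact add_self_vec v

/-- A nonzero vector has a coordinate equal to one. -/
theorem exists_coord_eq_one {v : Vec} (hv : v ≠ 0) : ∃ i, v i = 1 := by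
  by_contra! h
  exact hv (funext fun i => (zmod_two_cases (v i)).resolve_right (h i))

theorem sum_chi (v : Vec) : ∑ q, chi v q = if v = 0 then 32 else 0 := by
  split_ifs with hv
  · subst hv; simp [chi_zero]
  · obtain ⟨i, hi⟩ := exists_coord_eq_one hv
    -- Translation by a vector on which the character is -1 negates the sum.
    have h1 : ∑ q, chi v q = ∑ q, chi v (q + Pi.single i 1) :=
      (Fintype.sum_equiv (Equiv.addRight (Pi.single i 1 : Vec))
        (fun q => chi v (q + Pi.single i 1)) (chi v)
        fun q => by rw [Equiv.coe_addRight]).symm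
    have h2 : chi v (Pi.single i 1) = -1 := by simp [chi, hi]
    simp only [chi_add_right, h2] at h1
    rw [← Finset.sum_mul] at h1
    linarith

theorem sum_ind {v : Vec} (hv : v ≠ 0) : ∑ q, ind v q = 16 := by
  have h : ∑ q, (2 * ind v q) = ∑ q, (1 - chi v q) :=
    Finset.sum_congr rfl fun q _ => two_mul_ind v q
  rw [← Finset.mul_sum, Finset.sum_sub_distrib, sum_chi, if_neg hv] at h
  simp at h
  linarith

theorem sum_ind_mul_ind {v w : Vec} (hv : v ≠ 0) (hw : w ≠ 0) :
    ∑ q, ind v q * ind w q = 8 + if v = w then 8 else 0 := by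
  have h : ∑ q, 4 * (ind v q * ind w q) = ∑ q, (1 - chi v q - chi w q + chi (v + w) q) :=
    Finset.sum_congr rfl fun q _ => by
      rw [chi_add]
      linear_combination (2 * ind w q) * two_mul_ind v q + (1 - chi v q) * two_mul_ind w q
  rw [← Finset.mul_sum, Finset.sum_add_distrib, Finset.sum_sub_distrib, Finset.sum_sub_distrib,
    sum_chi, sum_chi, sum_chi, if_neg hv, if_neg hw] at h
  simp only [add_eq_zero_iff_vec] at h
  simp at h
  split_ifs at h ⊢ <;> linarith

theorem sum_orth_ind {p v : Vec} (hp : p ≠ 0) (hv : v ≠ 0) (hpv : v ≠ p) :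
    ∑ q, (1 - ind p q) * ind v q = 8 := by
  simp only [sub_mul, one_mul, Finset.sum_sub_distrib]
  rw [sum_ind hv, sum_ind_mul_ind hp hv, if_neg hpv.symm]
  norm_num

/-- On the hyperplane orthogonal to p, vectors matter only modulo p. The hypotheses exclude v or w
vanishing there, and v, w coinciding there without being equal. -/
theorem sum_orth_ind_mul_ind {p v w : Vec} (hp : p ≠ 0) (hv : v ≠ 0) (hw : w ≠ 0) (hvp : v ≠ p)
    (hwp : w ≠ p) (hvw : v + w ≠ p) :
    ∑ q, (1 - ind p q) * (ind v q * ind w q) = 4 + if v = w then 4 else 0 := by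
  have h : ∑ q, 8 * ((1 - ind p q) * (ind v q * ind w q)) =
      ∑ q, (1 - chi v q - chi w q + chi (v + w) q + chi p q - chi (p + v) q - chi (p + w) q
        + chi (p + (v + w)) q) :=
    Finset.sum_congr rfl fun q _ => by
      simp only [chi_add]
      linear_combination (-4 * (ind v q * ind w q)) * two_mul_ind p q +
        (1 + chi p q) * (2 * ind w q) * two_mul_ind v q +
        (1 + chi p q) * (1 - chi v q) * two_mul_ind w q
  rw [← Finset.mul_sum] at h
  simp only [Finset.sum_add_distrib, Finset.sum_sub_distrib, sum_chi, if_neg hv, if_neg hw,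
    if_neg hp, add_eq_zero_iff_vec, if_neg hvp.symm, if_neg hwp.symm, if_neg hvw.symm] at h
  simp at h
  split_ifs at h ⊢ <;> linarith

/-! ### Mass functions and their moments -/

/-- The total mass that `μ` puts on the vectors that are not orthogonal to `q`. -/
def mass (μ : Vec → ℤ) (q : Vec) : ℤ := ∑ v, μ v * ind v q

theorem sum_mul_mass (g μ : Vec → ℤ) :
    ∑ q, g q * mass μ q = ∑ v, μ v * ∑ q, g q * ind v q := by
  simp only [mass, Finset.mul_sum]
  rw [Finset.sum_comm]
  exact Finset.sum_congr rfl fun v _ => Finset.sum_congr rfl fun q _ => by ring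

theorem sum_mul_mass_sq (g μ : Vec → ℤ) :
    ∑ q, g q * mass μ q ^ 2 = ∑ v, ∑ w, μ v * μ w * ∑ q, g q * (ind v q * ind w q) := by
  have h : ∀ q, g q * mass μ q ^ 2 = ∑ v, ∑ w, μ v * μ w * (g q * (ind v q * ind w q)) := by
    intro q
    rw [mass, sq, Finset.sum_mul_sum, Finset.mul_sum]
    exact Finset.sum_congr rfl fun v _ => by
      rw [Finset.mul_sum]
      exact Finset.sum_congr rfl fun w _ => by ring
  simp only [h]
  rw [Finset.sum_comm]
  refine Finset.sum_congr rfl fun v _ => ?_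
  rw [Finset.sum_comm]
  exact Finset.sum_congr rfl fun w _ => by rw [Finset.mul_sum]

theorem sum_sum_diag (μ : Vec → ℤ) (a : ℤ) :
    ∑ v, ∑ w, μ v * μ w * (a + if v = w then a else 0) =
      a * (∑ v, μ v) ^ 2 + a * ∑ v, μ v ^ 2 := by
  simp only [mul_add, Finset.sum_add_distrib, mul_ite, mul_zero, Finset.sum_ite_eq,
    Finset.mem_univ, if_true]
  congr 1
  · rw [sq, Finset.sum_mul_sum, Finset.mul_sum]
    refine Finset.sum_congr rfl fun v _ => ?_
    rw [Finset.mul_sum]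
    exact Finset.sum_congr rfl fun w _ => by ring
  · rw [Finset.mul_sum]
    exact Finset.sum_congr rfl fun w _ => by ring

theorem sum_mass {μ : Vec → ℤ} (h0 : μ 0 = 0) : ∑ q, mass μ q = 16 * ∑ v, μ v := by
  have h := sum_mul_mass (fun _ => 1) μ
  simp only [one_mul] at h
  rw [h, Finset.mul_sum]
  refine Finset.sum_congr rfl fun v _ => ?_
  rcases eq_or_ne v 0 with rfl | hv
  · simp [h0]
  · rw [sum_ind hv]; ring

theorem sum_mass_sq {μ : Vec → ℤ} (h0 : μ 0 = 0) :
    ∑ q, mass μ q ^ 2 = 8 * (∑ v, μ v) ^ 2 + 8 * ∑ v, μ v ^ 2 := by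
  have h := sum_mul_mass_sq (fun _ => 1) μ
  simp only [one_mul] at h
  rw [h, ← sum_sum_diag]
  refine Finset.sum_congr rfl fun v _ => Finset.sum_congr rfl fun w _ => ?_
  rcases eq_or_ne v 0 with rfl | hv
  · simp [h0]
  rcases eq_or_ne w 0 with rfl | hw
  · simp [h0]
  rw [sum_ind_mul_ind hv hw]

theorem sum_orth_mass {μ : Vec → ℤ} {p : Vec} (hp : p ≠ 0) (h0 : μ 0 = 0) (h1 : μ p = 0) :
    ∑ q, (1 - ind p q) * mass μ q = 8 * ∑ v, μ v := by
  rw [sum_mul_mass (fun q => 1 - ind p q), Finset.mul_sum]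
  refine Finset.sum_congr rfl fun v _ => ?_
  rcases eq_or_ne v 0 with rfl | hv
  · simp [h0]
  rcases eq_or_ne v p with rfl | hvp
  · simp [h1]
  rw [sum_orth_ind hp hv hvp]; ring

theorem sum_orth_mass_sq {μ : Vec → ℤ} {p : Vec} (hp : p ≠ 0) (h0 : μ 0 = 0) (h1 : μ p = 0)
    (h2 : ∀ v w, v + w = p → μ v * μ w = 0) :
    ∑ q, (1 - ind p q) * mass μ q ^ 2 = 4 * (∑ v, μ v) ^ 2 + 4 * ∑ v, μ v ^ 2 := by
  rw [sum_mul_mass_sq (fun q => 1 - ind p q), ← sum_sum_diag]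
  refine Finset.sum_congr rfl fun v _ => Finset.sum_congr rfl fun w _ => ?_
  rcases eq_or_ne v 0 with rfl | hv
  · simp [h0]
  rcases eq_or_ne w 0 with rfl | hw
  · simp [h0]
  rcases eq_or_ne v p with rfl | hvp
  · simp [h1]
  rcases eq_or_ne w p with rfl | hwp
  · simp [h1]
  by_cases hvw : v + w = p
  · simp [h2 v w hvw]
  rw [sum_orth_ind_mul_ind hp hv hw hvp hwp hvw]

/-! ### Four-divisible mass functions -/

theorem ind_nonneg (v q : Vec) : 0 ≤ ind v q := by unfold ind; split_ifs <;> norm_num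

theorem ind_le_one (v q : Vec) : ind v q ≤ 1 := by unfold ind; split_ifs <;> norm_num

theorem ind_eq_zero_or_one (v q : Vec) : ind v q = 0 ∨ ind v q = 1 := by
  unfold ind; split_ifs <;> simp

theorem ind_add_right (v q r : Vec) :
    ind v (q + r) = ind v q + ind v r - 2 * (ind v q * ind v r) := by
  have h1 := two_mul_ind v (q + r)
  rw [chi_add_right] at h1
  have h2 := two_mul_ind v q
  have h3 := two_mul_ind v r
  have h4 : chi v q = 1 - 2 * ind v q := by linarith
  have h5 : chi v r = 1 - 2 * ind v r := by linarith
  rw [h4, h5] at h1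
  linarith

theorem ind_add_left (v w q : Vec) :
    ind (v + w) q = ind v q + ind w q - 2 * (ind v q * ind w q) := by
  rw [ind_comm, ind_add_right, ind_comm q v, ind_comm q w]

theorem ind_zero_left (q : Vec) : ind 0 q = 0 := by simp [ind]

theorem ind_zero_right (q : Vec) : ind q 0 = 0 := by simp [ind]

theorem ind_single (v : Vec) (i : Fin 5) : ind v (Pi.single i 1) = if v i = 1 then 1 else 0 := by
  simp [ind]

theorem mass_nonneg {μ : Vec → ℤ} (h : ∀ v, 0 ≤ μ v) (q : Vec) : 0 ≤ mass μ q :=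
  Finset.sum_nonneg fun v _ => mul_nonneg (h v) (ind_nonneg v q)

theorem mass_le_sum {μ : Vec → ℤ} (h : ∀ v, 0 ≤ μ v) (q : Vec) : mass μ q ≤ ∑ v, μ v :=
  Finset.sum_le_sum fun v _ => mul_le_of_le_one_right (h v) (ind_le_one v q)

/-- If all the masses of `μ` are even, then the vectors with odd multiplicity sum to zero. -/
theorem sum_odd_eq_zero {μ : Vec → ℤ} (h : ∀ q, Even (mass μ q)) :
    ∑ v with μ v % 2 = 1, v = 0 := by
  -- Modulo two, `mass μ q` is the dot product of this sum with q.
  have hs : ∑ v, ((μ v : ℤ) : ZMod 2) • v = 0 := by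
    refine dotProduct_eq_zero _ fun q => ?_
    have h1 : ((mass μ q : ℤ) : ZMod 2) = 0 := by
      rw [ZMod.intCast_zmod_eq_zero_iff_dvd]
      exact_mod_cast (h q).two_dvd
    rw [sum_dotProduct, ← h1, mass]
    push_cast
    refine Finset.sum_congr rfl fun v _ => ?_
    rw [smul_dotProduct, smul_eq_mul]
    congr 1
    unfold ind
    rcases zmod_two_cases (v ⬝ᵥ q) with h | h <;> rw [h] <;> simp
  rw [← hs, Finset.sum_filter]
  refine Finset.sum_congr rfl fun v _ => ?_
  split_ifs with hv
  · have : ((μ v : ℤ) : ZMod 2) = ((1 : ℤ) : ZMod 2) :=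
      (ZMod.intCast_eq_intCast_iff _ _ 2).2 (by rw [Int.ModEq]; exact_mod_cast hv)
    rw [this]; simp
  · have : ((μ v : ℤ) : ZMod 2) = 0 := by
      rw [ZMod.intCast_zmod_eq_zero_iff_dvd]; push_cast; omega
    rw [this]; simp

/-- If all the masses of `μ` are even, then neither one nor two vectors have odd multiplicity. -/
theorem sum_emod_two_ne {μ : Vec → ℤ} (h0 : μ 0 = 0) (h : ∀ q, Even (mass μ q)) :
    ∑ v, μ v % 2 ≠ 1 ∧ ∑ v, μ v % 2 ≠ 2 := by
  have hs := sum_odd_eq_zero h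
  have hc : ∑ v, μ v % 2 = ((Finset.univ.filter fun v => μ v % 2 = 1).card : ℤ) := by
    rw [Finset.card_filter]
    push_cast
    refine Finset.sum_congr rfl fun v _ => ?_
    split_ifs <;> omega
  rw [hc]
  constructor
  · intro h1
    obtain ⟨a, ha⟩ := Finset.card_eq_one.1 (by exact_mod_cast h1)
    have hm : a ∈ Finset.univ.filter fun v => μ v % 2 = 1 := by rw [ha]; simp
    rw [ha, Finset.sum_singleton] at hs
    subst hs
    simp [h0] at hm
  · intro h1
    obtain ⟨a, b, hab, ha⟩ := Finset.card_eq_two.1 (by exact_mod_cast h1)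
    rw [ha, Finset.sum_pair hab, add_eq_zero_iff_vec] at hs
    exact hab hs

theorem sum_eq_two_mul_add (μ : Vec → ℤ) : ∑ v, μ v = 2 * ∑ v, μ v / 2 + ∑ v, μ v % 2 := by
  rw [Finset.mul_sum, ← Finset.sum_add_distrib]
  exact Finset.sum_congr rfl fun v _ => by omega

/-- A mass function with even masses does not have total mass one. -/
theorem sum_ne_one {μ : Vec → ℤ} (h0 : μ 0 = 0) (hn : ∀ v, 0 ≤ μ v) (h : ∀ q, Even (mass μ q)) :
    ∑ v, μ v ≠ 1 := by
  intro h1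
  have h2 := sum_eq_two_mul_add μ
  have h3 : 0 ≤ ∑ v, μ v / 2 := Finset.sum_nonneg fun v _ => by have := hn v; omega
  have h4 : 0 ≤ ∑ v, μ v % 2 := Finset.sum_nonneg fun v _ => by omega
  have h5 := sum_emod_two_ne h0 h
  omega

/-- In a mass function with even masses and total mass four no vector has multiplicity three. -/
theorem ne_three_of_sum_eq_four {μ : Vec → ℤ} (h0 : μ 0 = 0) (hn : ∀ v, 0 ≤ μ v)
    (h : ∀ q, Even (mass μ q)) (h4 : ∑ v, μ v = 4) (v : Vec) : μ v ≠ 3 := by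
  intro hv
  have h2 := sum_eq_two_mul_add μ
  have h3 : μ v / 2 ≤ ∑ v, μ v / 2 :=
    Finset.single_le_sum (f := fun v => μ v / 2) (fun v _ => by have := hn v; omega)
      (Finset.mem_univ v)
  have h5 : μ v % 2 ≤ ∑ v, μ v % 2 :=
    Finset.single_le_sum (f := fun v => μ v % 2) (fun v _ => by omega) (Finset.mem_univ v)
  have h6 := sum_emod_two_ne h0 h
  omega

theorem sum_sq_le_mul {μ : Vec → ℤ} (hn : ∀ v, 0 ≤ μ v) {M : ℤ} (hM : ∀ v, μ v ≤ M) :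
    ∑ v, μ v ^ 2 ≤ M * ∑ v, μ v := by
  rw [Finset.mul_sum]
  exact Finset.sum_le_sum fun v _ => by nlinarith [hn v, hM v]

theorem sum_le_sum_sq (μ : Vec → ℤ) : ∑ v, μ v ≤ ∑ v, μ v ^ 2 :=
  Finset.sum_le_sum fun v _ => by
    rcases le_or_gt (μ v) 0 with h | h
    · nlinarith [sq_nonneg (μ v)]
    · nlinarith

theorem sum_sq_le_seven {μ : Vec → ℤ} (h0 : μ 0 = 0) (hn : ∀ v, 0 ≤ μ v) (h2 : ∀ v, μ v ≤ 2)
    (h : ∀ q, Even (mass μ q)) (h5 : ∑ v, μ v = 5) : ∑ v, μ v ^ 2 ≤ 7 := by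
  have e1 := sum_eq_two_mul_add μ
  have e2 : ∑ v, μ v ^ 2 = 4 * ∑ v, μ v / 2 + ∑ v, μ v % 2 := by
    rw [Finset.mul_sum, ← Finset.sum_add_distrib]
    refine Finset.sum_congr rfl fun v _ => ?_
    have h1 := hn v
    have h3 := h2 v
    interval_cases μ v <;> norm_num
  have e3 := sum_emod_two_ne h0 h
  have e4 : 0 ≤ ∑ v, μ v % 2 := Finset.sum_nonneg fun v _ => by omega
  omega

/-- If `μ` is bounded by `M` and its sum of squares is large, then it has two distinct vectors of
multiplicity at least two. -/
theorem exists_two_multiple {μ : Vec → ℤ} (hn : ∀ v, 0 ≤ μ v) {M : ℤ} (hM : ∀ v, μ v ≤ M)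
    (h : ∑ v, μ v + M * (M - 1) < ∑ v, μ v ^ 2) : ∃ p p', p ≠ p' ∧ 2 ≤ μ p ∧ 2 ≤ μ p' := by
  by_contra! hc
  have key : ∀ p : Vec, (∀ v, v ≠ p → μ v ≤ 1) → False := by
    intro p hp
    -- Multiplicities 0 and 1 contribute nothing to the left side, so p alone accounts for it.
    have h1 : ∑ v, (μ v ^ 2 - μ v) ≤ ∑ v, if v = p then M * (M - 1) else 0 :=
      Finset.sum_le_sum fun v _ => by
        have a := hn v
        have b := hM v
        split_ifs with hv
        · rcases eq_or_lt_of_le a with h0 | h0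
          · rw [← h0] at b ⊢
            rcases eq_or_lt_of_le b with h' | h' <;> nlinarith
          · nlinarith
        · have c := hp v hv
          nlinarith
    rw [Finset.sum_sub_distrib, Finset.sum_ite_eq' Finset.univ p] at h1
    simp at h1
    linarith
  by_cases hp : ∃ p, 2 ≤ μ p
  · obtain ⟨p, hp⟩ := hp
    exact key p fun v hv => by have := hc p v hv.symm hp; omega
  · push Not at hp
    exact key 0 fun v _ => by have := hp v; omega

/-- The part of `μ` on the hyperplane orthogonal to `e`. -/
def outer (μ : Vec → ℤ) (e v : Vec) : ℤ := μ v * (1 - ind v e)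

/-- The part of `μ` off the hyperplane orthogonal to `e`, with `p` removed. -/
def inner (μ : Vec → ℤ) (e p v : Vec) : ℤ := if v = p then 0 else μ v * ind v e

theorem two_mul_mass_outer (μ : Vec → ℤ) (e q : Vec) :
    2 * mass (outer μ e) q = mass μ q + mass μ (q + e) - mass μ e := by
  simp only [mass, Finset.mul_sum, ← Finset.sum_add_distrib, ← Finset.sum_sub_distrib]
  exact Finset.sum_congr rfl fun v _ => by rw [ind_add_right, outer]; ring

theorem two_mul_mass_inner (μ : Vec → ℤ) {e p q : Vec} (hq : ind p q = 0) :
    2 * mass (inner μ e p) q = mass μ q - mass μ (q + e) + mass μ e := by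
  simp only [mass, Finset.mul_sum, ← Finset.sum_add_distrib, ← Finset.sum_sub_distrib]
  refine Finset.sum_congr rfl fun v _ => ?_
  rw [ind_add_right, inner]
  split_ifs with hv
  · subst hv; rw [hq]; ring
  · ring

theorem sum_outer (μ : Vec → ℤ) (e : Vec) : ∑ v, outer μ e v = ∑ v, μ v - mass μ e := by
  simp only [mass, ← Finset.sum_sub_distrib, outer]
  exact Finset.sum_congr rfl fun v _ => by ring

theorem sum_inner (μ : Vec → ℤ) {e p : Vec} (hp : ind p e = 1) :
    ∑ v, inner μ e p v = mass μ e - μ p := by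
  have h : ∀ v, inner μ e p v = μ v * ind v e - if v = p then μ p else 0 := by
    intro v
    unfold inner
    split_ifs with hv
    · subst hv; rw [hp]; ring
    · ring
  simp only [h, Finset.sum_sub_distrib, mass]
  simp

theorem outer_nonneg {δ : Vec → ℤ} (hn : ∀ v, 0 ≤ δ v)
    (e v : Vec) : 0 ≤ outer δ e v :=
  mul_nonneg (hn v) (by have := ind_le_one v e; omega)

theorem outer_le {δ : Vec → ℤ} (hn : ∀ v, 0 ≤ δ v)
    (e v : Vec) : outer δ e v ≤ δ v :=
  mul_le_of_le_one_right (hn v) (by have := ind_nonneg v e; omega)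

theorem outer_zero {δ : Vec → ℤ} (h0 : δ 0 = 0)
    (e : Vec) : outer δ e 0 = 0 := by simp [outer, h0]

theorem mass_outer {δ F : Vec → ℤ} (hF : ∀ q, mass δ q = 4 * F q)
    (e q : Vec) : mass (outer δ e) q = 2 * F q + 2 * F (q + e) - 2 * F e := by
  have := two_mul_mass_outer δ e q
  simp only [hF] at this
  omega

/-- Residuals of four-divisible codes are even: this is what excludes small residual multisets. -/
theorem even_mass_outer {δ F : Vec → ℤ} (hF : ∀ q, mass δ q = 4 * F q)
    (e q : Vec) : Even (mass (outer δ e) q) := by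
  rw [mass_outer hF]
  exact ⟨F q + F (q + e) - F e, by ring⟩

theorem weight_nonneg {δ F : Vec → ℤ} (hn : ∀ v, 0 ≤ δ v) (hF : ∀ q, mass δ q = 4 * F q)
    (q : Vec) : 0 ≤ F q := by
  have := mass_nonneg hn q
  rw [hF] at this
  omega

theorem four_mul_weight_le {δ F : Vec → ℤ} (hn : ∀ v, 0 ≤ δ v) (hF : ∀ q, mass δ q = 4 * F q)
    (q : Vec) : 4 * F q ≤ ∑ v, δ v := by
  rw [← hF]; exact mass_le_sum hn q

theorem weight_zero {δ F : Vec → ℤ} (hF : ∀ q, mass δ q = 4 * F q) :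
    F 0 = 0 := by
  have h : mass δ 0 = 0 := by simp [mass, ind_zero_right]
  rw [hF] at h
  omega

theorem sum_weight {δ F : Vec → ℤ} (h0 : δ 0 = 0) (hF : ∀ q, mass δ q = 4 * F q) :
    ∑ q, F q = 4 * ∑ v, δ v := by
  have := sum_mass h0
  simp only [hF, ← Finset.mul_sum] at this
  linarith

theorem two_mul_sum_weight_sq {δ F : Vec → ℤ} (h0 : δ 0 = 0) (hF : ∀ q, mass δ q = 4 * F q) :
    2 * ∑ q, F q ^ 2 = (∑ v, δ v) ^ 2 + ∑ v, δ v ^ 2 := by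
  have := sum_mass_sq h0
  simp only [hF, mul_pow, ← Finset.mul_sum] at this
  linarith

/-- Lower bound for the sum of squares from the integrality of the weights. -/
theorem le_sum_sq {δ F : Vec → ℤ} (h0 : δ 0 = 0) (hF : ∀ q, mass δ q = 4 * F q) :
    24 * (∑ v, δ v) - 124 - (∑ v, δ v) ^ 2 ≤ ∑ v, δ v ^ 2 := by
  have h1 := sum_weight h0 hF
  have h2 := two_mul_sum_weight_sq h0 hF
  -- For an integer x, (x - 1)(x - 2) ≥ 0. The correction at the origin uses F 0 = 0 and sharpens
  -- the bound.
  have h3 : ∑ q, (3 * F q - 2 + if q = 0 then 2 else 0) ≤ ∑ q, F q ^ 2 := by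
    refine Finset.sum_le_sum fun q _ => ?_
    split_ifs with hq
    · subst hq; rw [weight_zero hF]; norm_num
    · rcases le_or_gt (F q) 1 with h | h <;> nlinarith
  rw [Finset.sum_add_distrib, Finset.sum_sub_distrib, ← Finset.mul_sum] at h3
  simp at h3
  linarith

theorem le_sum_sq' {δ F : Vec → ℤ} (h0 : δ 0 = 0) (hF : ∀ q, mass δ q = 4 * F q) :
    8 * (∑ v, δ v) - (∑ v, δ v) ^ 2 ≤ ∑ v, δ v ^ 2 := by
  have h1 := sum_weight h0 hF
  have h2 := two_mul_sum_weight_sq h0 hF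
  have h3 := sum_le_sum_sq F
  linarith

/-- The residual part of a four-divisible mass function with respect to a word of weight eight and
a vector of multiplicity two inside its support. -/
theorem sum_sq_outer_ge {δ F : Vec → ℤ} (h0 : δ 0 = 0) (hn : ∀ v, 0 ≤ δ v)
    (hF : ∀ q, mass δ q = 4 * F q) {e p : Vec} (hpe : ind p e = 1) (hp : δ p = 2) (hFe : F e = 2)
    (hD : ∑ v, δ v ≤ 13) (hq : ∀ q, ind p q = 0 → F q ≤ F (q + e)) :
    8 * (∑ v, outer δ e v) - (∑ v, outer δ e v) ^ 2 - 6 ≤ ∑ v, outer δ e v ^ 2 := by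
  have hp0 : p ≠ 0 := by rintro rfl; rw [ind_zero_left] at hpe; omega
  have hN : ∑ v, inner δ e p v = 6 := by rw [sum_inner δ hpe, hF, hFe, hp]; norm_num
  have hO : ∑ v, outer δ e v ≤ 5 := by rw [sum_outer, hF, hFe]; omega
  have hin0 : inner δ e p 0 = 0 := by unfold inner; simp [h0]
  have hinp : inner δ e p p = 0 := by simp [inner]
  have houtp : outer δ e p = 0 := by simp [outer, hpe]
  -- As p is off the hyperplane of e, two vectors with sum p lie on different sides of it. Hence
  -- neither part contains such a pair, and `sum_orth_mass_sq` applies to both.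
  have hsplit : ∀ v w, v + w = p → ind v e = 1 - ind w e := by
    intro v w hvw
    have h1 := ind_add_left v w e
    rw [hvw, hpe] at h1
    rcases ind_eq_zero_or_one v e with h | h <;> rcases ind_eq_zero_or_one w e with h' | h' <;>
      rw [h, h'] at h1 ⊢ <;> omega
  have hin2 : ∀ v w, v + w = p → inner δ e p v * inner δ e p w = 0 := by
    intro v w hvw
    have := hsplit v w hvw
    unfold inner
    split_ifs <;> try simp
    rcases ind_eq_zero_or_one w e with h | h <;> simp [this, h]
  have hout2 : ∀ v w, v + w = p → outer δ e v * outer δ e w = 0 := by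
    intro v w hvw
    have := hsplit v w hvw
    unfold outer
    rcases ind_eq_zero_or_one w e with h | h <;> simp [this, h]
  -- For q orthogonal to p both masses lie in {0, 2, 4}, and they differ by a multiple of four. The
  -- polynomial x² - 4x takes equal values at 0 and 4, so it cannot tell them apart.
  have key : ∑ q, (1 - ind p q) * (mass (inner δ e p) q ^ 2 - 4 * mass (inner δ e p) q) =
      ∑ q, (1 - ind p q) * (mass (outer δ e) q ^ 2 - 4 * mass (outer δ e) q) := by
    refine Finset.sum_congr rfl fun q _ => ?_
    rcases ind_eq_zero_or_one p q with h | h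
    · have i1 := two_mul_mass_inner δ (e := e) h
      rw [hF, hF, hF, hFe] at i1
      have i2 := mass_outer hF e q
      rw [hFe] at i2
      have i3 := hq q h
      have i4 := mass_le_sum (outer_nonneg hn e) q
      have i5 := mass_nonneg (outer_nonneg hn e) q
      have i6 : 0 ≤ mass (inner δ e p) q := mass_nonneg (fun v => by
        unfold inner
        split_ifs
        · exact le_rfl
        · exact mul_nonneg (hn v) (ind_nonneg v e)) q
      have i7 : mass (inner δ e p) q = 2 * F q - 2 * F (q + e) + 4 := by omega
      have i8 : F q - F (q + e) = 0 ∨ F q - F (q + e) = -1 ∨ F q - F (q + e) = -2 := by omega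
      have i9 : F q + F (q + e) = 2 ∨ F q + F (q + e) = 3 ∨ F q + F (q + e) = 4 := by omega
      congr 1
      have j1 : mass (inner δ e p) q = 0 ∧ mass (outer δ e) q = 0 ∨
          mass (inner δ e p) q = 0 ∧ mass (outer δ e) q = 4 ∨
          mass (inner δ e p) q = 2 ∧ mass (outer δ e) q = 2 ∨
          mass (inner δ e p) q = 4 ∧ mass (outer δ e) q = 0 ∨
          mass (inner δ e p) q = 4 ∧ mass (outer δ e) q = 4 := by omega
      rcases j1 with ⟨a, b⟩ | ⟨a, b⟩ | ⟨a, b⟩ | ⟨a, b⟩ | ⟨a, b⟩ <;> rw [a, b] <;> norm_num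
    · simp [h]
  simp only [mul_sub, Finset.sum_sub_distrib, mul_left_comm _ (4 : ℤ), ← Finset.mul_sum] at key
  rw [sum_orth_mass_sq hp0 hin0 hinp hin2, sum_orth_mass hp0 hin0 hinp,
    sum_orth_mass_sq hp0 (outer_zero h0 e) houtp hout2, sum_orth_mass hp0 (outer_zero h0 e) houtp,
    hN] at key
  have := sum_le_sum_sq (inner δ e p)
  rw [hN] at this
  linarith

/-- A four-divisible mass function of total mass at least ten and at most thirteen violates the
recovery inequalities at some unit vector. -/
theorem false_of_sum_mem_Icc {δ F : Vec → ℤ} (h0 : δ 0 = 0) (hn : ∀ v, 0 ≤ δ v)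
    (hF : ∀ q, mass δ q = 4 * F q) (h1 : ∀ i v, v i = 1 → δ v ≤ F (Pi.single i 1))
    (h2 : ∀ i v q, v i = 1 → ind v q = 0 →
      δ v + F q ≤ F (Pi.single i 1) + F (Pi.single i 1 + q))
    (hD : 10 ≤ ∑ v, δ v) (hD' : ∑ v, δ v ≤ 13) : False := by
  have hF3 : ∀ q, F q ≤ 3 := fun q => by have := four_mul_weight_le hn hF q; omega
  -- Weight 12 inside total mass 13 would leave a residual of mass one, which is not even.
  have hF2 : ∑ v, δ v ≠ 12 → ∀ q, F q ≤ 2 := by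
    intro h12 q
    by_contra hq
    have hq3 : F q = 3 := by have := hF3 q; omega
    refine sum_ne_one (outer_zero h0 q) (outer_nonneg hn q) (even_mass_outer hF q) ?_
    rw [sum_outer, hF, hq3]
    have := four_mul_weight_le hn hF q
    omega
  have hle : ∀ M : ℤ, 0 ≤ M → (∀ q, F q ≤ M) → ∀ v, δ v ≤ M := by
    intro M hM hFM v
    rcases eq_or_ne v 0 with rfl | hv
    · rw [h0]; exact hM
    · obtain ⟨i, hi⟩ := exists_coord_eq_one hv
      exact (h1 i v hi).trans (hFM _)
  have hδ3 := hle 3 (by norm_num) hF3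
  have hδ2 : ∑ v, δ v ≠ 12 → ∀ v, δ v ≤ 2 := fun h => hle 2 (by norm_num) (hF2 h)
  have hsq := le_sum_sq h0 hF
  obtain ⟨p, p', hpp, hp, hp'⟩ : ∃ p p', p ≠ p' ∧ 2 ≤ δ p ∧ 2 ≤ δ p' := by
    by_cases h12 : ∑ v, δ v = 12
    · refine exists_two_multiple hn hδ3 ?_
      rw [h12] at hsq ⊢
      linarith
    · refine exists_two_multiple hn (hδ2 h12) ?_
      have : ∑ v, δ v = 10 ∨ ∑ v, δ v = 11 ∨ ∑ v, δ v = 13 := by omega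
      rcases this with h | h | h <;> rw [h] at hsq ⊢ <;> linarith
  -- A coordinate separating the two repeated vectors puts one on each side of the hyperplane of
  -- e_i.
  obtain ⟨i, hi⟩ := exists_coord_eq_one (mt (add_eq_zero_iff_vec p p').1 hpp)
  have main : ∀ p p' : Vec, 2 ≤ δ p → 2 ≤ δ p' → p i = 1 → p' i = 0 → False := by
    intro p p' hp hp' hpi hpi'
    set e : Vec := Pi.single i 1 with he
    have hpe : ind p e = 1 := by rw [ind_single, if_pos hpi]
    have hpe' : ind p' e = 0 := by rw [ind_single, if_neg (by rw [hpi']; decide)]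
    have o1 : δ p' ≤ ∑ v, outer δ e v := by
      have := Finset.single_le_sum (f := outer δ e) (fun v _ => outer_nonneg hn e v)
        (Finset.mem_univ p')
      simpa [outer, hpe'] using this
    have o2 := sum_outer δ e
    rw [hF] at o2
    have hp1 : δ p ≤ F e := h1 i p hpi
    -- F e = 3 would leave residual mass at most one, but p' already contributes two.
    have hFe : F e = 2 := by have := hF3 e; omega
    have hp2 : δ p = 2 := by omega
    have hfin := sum_sq_outer_ge h0 hn hF hpe hp2 hFe hD' fun q hq => by
      have := h2 i p q hpi hq
      rw [← he, hp2, hFe, add_comm e q] at this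
      omega
    have hon := outer_nonneg hn e
    have hoe := even_mass_outer hF e
    have hle := outer_le hn e
    rw [hFe] at o2
    have : ∑ v, δ v = 10 ∨ ∑ v, δ v = 11 ∨ ∑ v, δ v = 12 ∨ ∑ v, δ v = 13 := by omega
    -- The residual has mass 2, 3, 4, 5; its sum of squares is at least 6, 9, 10, 9 by `hfin`, but
    -- at most 4, 6, 8, 7.
    rcases this with h | h | h | h <;> rw [h] at o2 <;> norm_num at o2 <;> rw [o2] at hfin
    · have := sum_sq_le_mul hon fun v => (hle v).trans (hδ2 (by omega) v)
      rw [o2] at this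
      linarith
    · have := sum_sq_le_mul hon fun v => (hle v).trans (hδ2 (by omega) v)
      rw [o2] at this
      linarith
    · have := sum_sq_le_mul hon (M := 2) fun v => by
        have a := (hle v).trans (hδ3 v)
        have b := ne_three_of_sum_eq_four (outer_zero h0 e) hon hoe o2 v
        omega
      rw [o2] at this
      linarith
    · have := sum_sq_le_seven (outer_zero h0 e) hon (fun v => (hle v).trans (hδ2 (by omega) v))
        hoe o2
      linarith
  rw [Pi.add_apply] at hi
  rcases zmod_two_cases (p i) with a | a <;> rcases zmod_two_cases (p' i) with b | b <;>
    rw [a, b] at hi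
  · exact absurd hi (by decide)
  · exact main p' p hp' hp b a
  · exact main p p' hp hp' a b
  · exact absurd hi (by decide)

theorem sum_ne_nine {δ F : Vec → ℤ} (h0 : δ 0 = 0) (hn : ∀ v, 0 ≤ δ v)
    (hF : ∀ q, mass δ q = 4 * F q) (h1 : ∀ i v, v i = 1 → δ v ≤ F (Pi.single i 1)) :
    ∑ v, δ v ≠ 9 := by
  intro hD
  have hsq := le_sum_sq h0 hF
  obtain ⟨p, hp⟩ : ∃ p, 2 ≤ δ p := by
    by_contra! hc
    have := sum_sq_le_mul hn (M := 1) fun v => by have := hc v; omega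
    rw [hD] at hsq this
    linarith
  have hp0 : p ≠ 0 := by rintro rfl; omega
  obtain ⟨i, hi⟩ := exists_coord_eq_one hp0
  have a := h1 i p hi
  have b := four_mul_weight_le hn hF (Pi.single i 1)
  refine sum_ne_one (outer_zero h0 _) (outer_nonneg hn _) (even_mass_outer hF (Pi.single i 1)) ?_
  rw [sum_outer, hF, hD]
  omega

theorem sum_ne_six {δ F : Vec → ℤ} (h0 : δ 0 = 0) (hn : ∀ v, 0 ≤ δ v)
    (hF : ∀ q, mass δ q = 4 * F q) (h1 : ∀ i v, v i = 1 → δ v ≤ F (Pi.single i 1)) :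
    ∑ v, δ v ≠ 6 := by
  intro hD
  have hsq := le_sum_sq' h0 hF
  obtain ⟨p, hp⟩ : ∃ p, 2 ≤ δ p := by
    by_contra! hc
    have := sum_sq_le_mul hn (M := 1) fun v => by have := hc v; omega
    rw [hD] at hsq this
    linarith
  have hp0 : p ≠ 0 := by rintro rfl; omega
  obtain ⟨i, hi⟩ := exists_coord_eq_one hp0
  have a := h1 i p hi
  have b := four_mul_weight_le hn hF (Pi.single i 1)
  omega

/-! ### Packings of recovery sets -/

/-- The family `c` contains `k` pairwise disjoint subfamilies with sum `e`. -/
def Packing {ι : Type*} (c : ι → Vec) (k : ℕ) (e : Vec) : Prop :=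
  ∃ R : Fin k → Finset ι, (∀ j j', j ≠ j' → Disjoint (R j) (R j')) ∧ ∀ j, ∑ h ∈ R j, c h = e

/-- The family `c` is the family of columns of a generator matrix of a `k`-PIR code. -/
def PIRFamily {ι : Type*} (c : ι → Vec) (k : ℕ) : Prop :=
  ∀ i, Packing c k (Pi.single i 1)

theorem Packing.map {ι κ : Type*} {c : ι → Vec} {d : κ → Vec} {k : ℕ} {e : Vec}
    (h : Packing c k e) (f : ι ↪ κ) (hf : ∀ j, d (f j) = c j) : Packing d k e := by
  obtain ⟨R, hR, hs⟩ := h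
  refine ⟨fun j => (R j).map f, fun j j' hj => (Finset.disjoint_map f).2 (hR j j' hj), fun j => ?_⟩
  rw [Finset.sum_map]
  simp only [hf, hs]

theorem Packing.sumElim {ι κ : Type*} {c : ι → Vec} {d : κ → Vec} {k l : ℕ} {e : Vec}
    (hc : Packing c k e) (hd : Packing d l e) : Packing (Sum.elim c d) (k + l) e := by
  obtain ⟨R, hR, hs⟩ := hc
  obtain ⟨R', hR', hs'⟩ := hd
  have hdis : ∀ j j', Disjoint ((R j).map (Function.Embedding.inl : ι ↪ ι ⊕ κ))
      ((R' j').map Function.Embedding.inr) := fun j j' =>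
    Finset.disjoint_left.2 fun a ha hb => by
      obtain ⟨x, -, rfl⟩ := Finset.mem_map.1 ha
      obtain ⟨y, -, hy⟩ := Finset.mem_map.1 hb
      exact Sum.inr_ne_inl hy
  refine ⟨Fin.append (fun j => (R j).map Function.Embedding.inl)
    fun j => (R' j).map Function.Embedding.inr, fun j j' => ?_, fun j => ?_⟩
  · refine Fin.addCases (fun a => ?_) (fun a => ?_) j <;>
      refine Fin.addCases (fun b => ?_) (fun b => ?_) j' <;> intro hab <;>
      simp only [Fin.append_left, Fin.append_right]
    · exact (Finset.disjoint_map _).2 (hR a b fun h => hab (by rw [h]))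
    · exact hdis a b
    · exact (hdis b a).symm
    · exact (Finset.disjoint_map _).2 (hR' a b fun h => hab (by rw [h]))
  · refine Fin.addCases (fun a => ?_) (fun a => ?_) j
    · simp [hs]
    · simp [hs']

theorem PIRFamily.exists_fin {ι : Type*} [Fintype ι] {c : ι → Vec} {k n : ℕ}
    (h : PIRFamily c k) (hn : Fintype.card ι = n) : ∃ d : Fin n → Vec, PIRFamily d k :=
  ⟨c ∘ (Fintype.equivFinOfCardEq hn).symm, fun i => (h i).map
    (Fintype.equivFinOfCardEq hn).toEmbedding fun j => by simp⟩

/-- Independence of the rows is automatic: a row relation annihilates every column, hence every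
recovered unit vector. -/
theorem exists_isPIRCode_iff {n k : ℕ} (hk : 0 < k) :
    (∃ C, IsPIRCode n 5 k C) ↔ ∃ c : Fin n → Vec, PIRFamily c k := by
  constructor
  · rintro ⟨C, G, -, h⟩
    exact ⟨fun h => G.col h, h⟩
  · rintro ⟨c, hc⟩
    refine ⟨_, Matrix.of fun i j => c j i, ⟨?_, rfl⟩, hc⟩
    rw [Fintype.linearIndependent_iff]
    intro g hg i
    obtain ⟨R, -, hR⟩ := hc i
    have h1 := hR ⟨0, hk⟩
    have h2 : ∀ j, g ⬝ᵥ c j = 0 := fun j => by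
      have := congrFun hg j
      simpa [dotProduct, Finset.sum_apply] using this
    have h3 : g ⬝ᵥ ∑ h ∈ R ⟨0, hk⟩, c h = 0 := by
      rw [dotProduct_sum]
      exact Finset.sum_eq_zero fun j _ => h2 j
    rw [h1] at h3
    simpa using h3

/-- A subadditive function bounds the size of a packing. -/
theorem Packing.mul_le_sum {ι : Type*} [Fintype ι] {c : ι → Vec} {k : ℕ} {e : Vec}
    (h : Packing c k e) (w : Vec → ℕ) (w0 : w 0 = 0) (hw : ∀ a b, w (a + b) ≤ w a + w b) :
    k * w e ≤ ∑ j, w (c j) := by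
  classical
  obtain ⟨R, hR, hs⟩ := h
  calc k * w e = ∑ j : Fin k, w (∑ h ∈ R j, c h) := by simp [hs]
    _ ≤ ∑ j : Fin k, ∑ h ∈ R j, w (c h) :=
        Finset.sum_le_sum fun j _ => Finset.le_sum_of_subadditive w w0.le hw _ _
    _ = ∑ h ∈ Finset.univ.biUnion R, w (c h) :=
        (Finset.sum_biUnion fun j _ j' _ hj => hR j j' hj).symm
    _ ≤ ∑ h, w (c h) := Finset.sum_le_sum_of_subset (Finset.subset_univ _)

/-! ### Normalization -/

/-- Replacing one column by the sum of the others preserves packings of even size. -/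
theorem Packing.update_sum {ι : Type*} [Fintype ι] [DecidableEq ι] {c : ι → Vec} {k : ℕ} {e : Vec}
    (hk : Even k) (hk0 : 0 < k) (h : Packing c k e) (j₀ : ι) :
    Packing (Function.update c j₀ (∑ j ∈ Finset.univ.erase j₀, c j)) k e := by
  obtain ⟨R, hR, hs⟩ := h
  set d := Function.update c j₀ (∑ j ∈ Finset.univ.erase j₀, c j) with hd
  have hdsum : ∑ j, d j = 0 := by
    rw [← Finset.add_sum_erase _ _ (Finset.mem_univ j₀), hd, Function.update_self,
      add_eq_zero_iff_vec]
    exact Finset.sum_congr rfl fun j hj =>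
      (Function.update_of_ne (Finset.ne_of_mem_erase hj) _ _).symm
  obtain ⟨a, ha⟩ : ∃ a : Fin k, ∀ j, j ≠ a → j₀ ∉ R j := by
    by_cases hex : ∃ a, j₀ ∈ R a
    · obtain ⟨a, ha⟩ := hex
      exact ⟨a, fun j hj hm => Finset.disjoint_left.1 (hR j a hj) hm ha⟩
    · push Not at hex
      exact ⟨⟨0, hk0⟩, fun j _ => hex j⟩
  have hds : ∀ j, j ≠ a → ∑ h ∈ R j, d h = e := fun j hj => by
    rw [← hs j]
    refine Finset.sum_congr rfl fun h hh => Function.update_of_ne ?_ _ _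
    rintro rfl
    exact ha j hj hh
  -- The k - 1 sets other than `R a` avoid j₀. Their number is odd, so their union sums to e; since
  -- all columns now sum to zero, so does its complement, which replaces `R a`.
  set U := (Finset.univ.erase a).biUnion R with hU
  refine ⟨Function.update R a Uᶜ, ?_, ?_⟩
  · have key : ∀ j, j ≠ a → Disjoint (R j) Uᶜ := fun j hj =>
      disjoint_compl_right.mono_left
        (Finset.subset_biUnion_of_mem R (Finset.mem_erase.2 ⟨hj, Finset.mem_univ j⟩))
    intro j j' hj
    rcases eq_or_ne j a with rfl | h1
    · rw [Function.update_self, Function.update_of_ne hj.symm]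
      exact (key j' hj.symm).symm
    · rcases eq_or_ne j' a with rfl | h2
      · rw [Function.update_self, Function.update_of_ne hj]
        exact key j hj
      · rw [Function.update_of_ne h1, Function.update_of_ne h2]
        exact hR j j' hj
  · intro j
    rcases eq_or_ne j a with rfl | h1
    · rw [Function.update_self]
      have hUs : ∑ h ∈ U, d h = e := by
        rw [hU, Finset.sum_biUnion fun x _ y _ hxy => hR x y hxy,
          Finset.sum_congr rfl fun x hx => hds x (Finset.ne_of_mem_erase hx), Finset.sum_const,
          Finset.card_erase_of_mem (Finset.mem_univ j), Finset.card_univ, Fintype.card_fin]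
        obtain ⟨m, rfl⟩ := hk
        have : m + m - 1 = (m - 1) + (m - 1) + 1 := by omega
        rw [this, add_nsmul, add_nsmul, add_self_vec, zero_add, one_nsmul]
      have := Finset.sum_add_sum_compl U d
      rw [hdsum, hUs, add_eq_zero_iff_vec] at this
      exact this.symm
    · rw [Function.update_of_ne h1]
      exact hds j h1

/-- Zero columns may be replaced by arbitrary vectors. -/
theorem Packing.replace_zero {ι : Type*} {c : ι → Vec} {k : ℕ} {e : Vec}
    (h : Packing c k e) (a : Vec) : Packing (fun j => if c j = 0 then a else c j) k e := by
  obtain ⟨R, hR, hs⟩ := h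
  refine ⟨fun j => (R j).filter fun h => c h ≠ 0, fun j j' hj =>
    Finset.disjoint_filter_filter (hR j j' hj), fun j => ?_⟩
  rw [← hs j, ← Finset.sum_filter_ne_zero (R j)]
  exact Finset.sum_congr rfl fun h hh => if_neg (Finset.mem_filter.1 hh).2

/-- A PIR family for even `k` can be modified to have nonzero members and sum zero. -/
theorem PIRFamily.exists_normalized {n k : ℕ} (hk : Even k) (hk0 : 0 < k) {c : Fin n → Vec}
    (h : PIRFamily c k) :
    ∃ d : Fin n → Vec, PIRFamily d k ∧ (∀ j, d j ≠ 0) ∧ ∑ j, d j = 0 := by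
  obtain ⟨c', hc', h0⟩ : ∃ c' : Fin n → Vec, PIRFamily c' k ∧ ∀ j, c' j ≠ 0 := by
    refine ⟨_, fun i => (h i).replace_zero (Pi.single 0 1), fun j => ?_⟩
    split_ifs with hj
    · decide
    · exact hj
  -- The replaced column must stay nonzero. If no choice worked, all columns would be equal and
  -- could not generate two different unit vectors.
  obtain ⟨j₀, hj₀⟩ : ∃ j₀, ∑ j ∈ Finset.univ.erase j₀, c' j ≠ 0 := by
    by_contra! hc
    have hall : ∀ j, c' j = ∑ j, c' j := fun j => by
      rw [← Finset.add_sum_erase _ _ (Finset.mem_univ j), hc j, add_zero]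
    have hmem : ∀ i : Fin 5, (Pi.single i 1 : Vec) = ∑ j, c' j := fun i => by
      obtain ⟨R, -, hR⟩ := hc' i
      have h1 := hR ⟨0, hk0⟩
      rw [Finset.sum_congr rfl fun j _ => hall j, Finset.sum_const] at h1
      rcases Nat.even_or_odd' (R ⟨0, hk0⟩).card with ⟨m, hm | hm⟩
      · rw [hm, two_mul, add_nsmul, add_self_vec] at h1
        have := congrFun h1 i
        simp at this
      · rw [hm, two_mul, add_nsmul, add_nsmul, add_self_vec, zero_add, one_nsmul] at h1
        exact h1.symm
    have := (hmem 0).trans (hmem 1).symm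
    revert this
    decide
  refine ⟨_, fun i => (hc' i).update_sum hk hk0 j₀, fun j => ?_, ?_⟩
  · rcases eq_or_ne j j₀ with rfl | hj
    · rwa [Function.update_self]
    · rw [Function.update_of_ne hj]
      exact h0 j
  · rw [← Finset.add_sum_erase _ _ (Finset.mem_univ j₀), Function.update_self, add_eq_zero_iff_vec]
    exact Finset.sum_congr rfl fun j hj =>
      (Function.update_of_ne (Finset.ne_of_mem_erase hj) _ _).symm

/-! ### The recovery inequalities -/

/-- A subadditive function on `Vec`: the pullback along the quotient by `q` of the graph metric,
from zero, of the complete bipartite graph between the kernel of `v` and its complement with the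
perfect matching along `e` removed. -/
def cover (e q v h : Vec) : ℕ :=
  if h = 0 ∨ h = q then 0 else if h = e ∨ h = e + q then 3 else if v ⬝ᵥ h = 1 then 1 else 2

theorem cover_add_left {q v : Vec} (hq : v ⬝ᵥ q = 0) (e b : Vec) :
    cover e q v (q + b) = cover e q v b := by
  have hqb : ∀ c : Vec, q + b = c ↔ b = c + q := fun c => by
    constructor
    · rintro rfl
      rw [add_comm q b, add_assoc, add_self_vec, add_zero]
    · rintro rfl
      rw [add_comm c q, ← add_assoc, add_self_vec, zero_add]
  have h1 : (q + b = 0 ∨ q + b = q) ↔ (b = 0 ∨ b = q) := by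
    rw [hqb, hqb, zero_add, add_self_vec, or_comm]
  have h2 : (q + b = e ∨ q + b = e + q) ↔ (b = e ∨ b = e + q) := by
    rw [hqb, hqb, add_assoc e q q, add_self_vec, add_zero, or_comm]
  unfold cover
  simp only [h1, h2, dotProduct_add, hq, zero_add]

theorem cover_add_le {e q v : Vec} (he : v ⬝ᵥ e = 1) (hq : v ⬝ᵥ q = 0) (a b : Vec) :
    cover e q v (a + b) ≤ cover e q v a + cover e q v b := by
  by_cases ha : a = 0 ∨ a = q
  · rcases ha with rfl | rfl
    · rw [zero_add]; exact Nat.le_add_left _ _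
    · rw [cover_add_left hq]; exact Nat.le_add_left _ _
  by_cases hb : b = 0 ∨ b = q
  · rcases hb with rfl | rfl
    · rw [add_zero]; exact Nat.le_add_right _ _
    · rw [add_comm a, cover_add_left hq]; exact Nat.le_add_right _ _
  have h1 : ∀ c, ¬(c = 0 ∨ c = q) → 1 ≤ cover e q v c := fun c hc => by
    unfold cover; rw [if_neg hc]; split_ifs <;> omega
  have h2 : ∀ c, ¬(c = 0 ∨ c = q) → v ⬝ᵥ c = 0 → 2 ≤ cover e q v c := fun c hc h0 => by
    unfold cover; rw [if_neg hc, h0]; split_ifs <;> first | omega | simp_all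
  have ha1 := h1 a ha
  have hb1 := h1 b hb
  -- Both terms are at least one, so only the value 3 is at stake. There exactly one of a, b lies in
  -- the kernel of v, and that one costs at least two.
  by_cases hab : a + b = e ∨ a + b = e + q
  · have hle : cover e q v (a + b) ≤ 3 := by unfold cover; split_ifs <;> omega
    have hv : v ⬝ᵥ a + v ⬝ᵥ b = 1 := by
      rw [← dotProduct_add]
      rcases hab with h | h <;> rw [h]
      · exact he
      · rw [dotProduct_add, he, hq, add_zero]
    rcases zmod_two_cases (v ⬝ᵥ a) with h | h
    · have := h2 a ha h; omega
    · have h0 : v ⬝ᵥ b = 0 := by rw [h] at hv; simpa using hv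
      have := h2 b hb h0; omega
  · have hle : cover e q v (a + b) ≤ 2 := by
      unfold cover; rw [if_neg hab]; split_ifs <;> omega
    omega

/-- The number of members of the family `d` equal to `h`. -/
def mult {n : ℕ} (d : Fin n → Vec) (h : Vec) : ℤ := ∑ j, if d j = h then 1 else 0

/-- The weight of the codeword with coefficient vector `v`. -/
def wt {n : ℕ} (d : Fin n → Vec) (v : Vec) : ℤ := ∑ j, ind v (d j)

section Inequalities

variable {n k : ℕ} {d : Fin n → Vec}

theorem PIRFamily.le_wt (h : PIRFamily d k) {v : Vec} (hv : v ≠ 0) : (k : ℤ) ≤ wt d v := by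
  obtain ⟨i, hi⟩ := exists_coord_eq_one hv
  have := (h i).mul_le_sum (fun h => if v ⬝ᵥ h = 1 then 1 else 0) (by simp) fun a b => by
    rw [dotProduct_add]
    rcases zmod_two_cases (v ⬝ᵥ a) with h | h <;> rcases zmod_two_cases (v ⬝ᵥ b) with h' | h' <;>
      rw [h, h'] <;> decide
  simp only [dotProduct_single, hi, mul_one, if_true] at this
  unfold wt ind
  exact_mod_cast this

theorem even_wt (hs : ∑ j, d j = 0) (v : Vec) : Even (wt d v) := by
  have h1 : ((wt d v : ℤ) : ZMod 2) = v ⬝ᵥ ∑ j, d j := by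
    rw [dotProduct_sum, wt]
    push_cast
    refine Finset.sum_congr rfl fun j _ => ?_
    unfold ind
    rcases zmod_two_cases (v ⬝ᵥ d j) with h | h <;> rw [h] <;> simp
  rw [hs, dotProduct_zero, ZMod.intCast_zmod_eq_zero_iff_dvd] at h1
  exact even_iff_two_dvd.2 (by exact_mod_cast h1)

theorem sum_wt (h0 : ∀ j, d j ≠ 0) : ∑ v, wt d v = 16 * n := by
  unfold wt
  rw [Finset.sum_comm]
  simp only [fun j v => ind_comm v (d j), fun j => sum_ind (h0 j)]
  simp
  ring

theorem sum_wt_mul_ind (h0 : ∀ j, d j ≠ 0) {h : Vec} (hh : h ≠ 0) :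
    ∑ v, wt d v * ind v h = 8 * n + 8 * mult d h := by
  simp only [wt, Finset.sum_mul]
  rw [Finset.sum_comm]
  simp only [fun v => ind_comm v h, fun j v => ind_comm v (d j),
    fun j => sum_ind_mul_ind (h0 j) hh, Finset.sum_add_distrib, mult, Finset.mul_sum, mul_ite,
    mul_one, mul_zero]
  simp
  ring

/-- Each recovery set costs at least 3 under `cover` with q = 0, and the right side is the total
cost of the columns. -/
theorem PIRFamily.recovery (h : PIRFamily d k) (h0 : ∀ j, d j ≠ 0) {i : Fin 5} {v : Vec}
    (hv : v i = 1) : 3 * (k : ℤ) ≤ 2 * n - wt d v + 2 * mult d (Pi.single i 1) := by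
  set e : Vec := Pi.single i 1 with he
  have hve : v ⬝ᵥ e = 1 := by simp [he, hv]
  have h1 := (h i).mul_le_sum (cover e 0 v) (by simp [cover])
    (cover_add_le hve (dotProduct_zero v))
  have h2 : cover e 0 v e = 3 := by
    have : e ≠ 0 := by rintro h; rw [h] at hve; simp at hve
    simp [cover, this]
  have h3 : ∀ j, (cover e 0 v (d j) : ℤ) =
      2 - ind v (d j) + 2 * if d j = e then 1 else 0 := fun j => by
    unfold cover ind
    simp only [add_zero, or_self, if_neg (h0 j)]
    by_cases hj : d j = e
    · simp [hj, hve]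
    · simp only [hj, if_false]; split_ifs <;> norm_num
  rw [← he, h2] at h1
  have h4 : ((k * 3 : ℕ) : ℤ) ≤ ∑ j, (cover e 0 v (d j) : ℤ) := by exact_mod_cast h1
  simp only [h3, Finset.sum_add_distrib, Finset.sum_sub_distrib, ← Finset.mul_sum] at h4
  simp at h4
  unfold wt mult
  simp
  linarith

theorem PIRFamily.recovery_quotient (h : PIRFamily d k) (h0 : ∀ j, d j ≠ 0) {i : Fin 5}
    {v q : Vec} (hv : v i = 1) (hq : v ⬝ᵥ q = 0) (hq0 : q ≠ 0) :
    3 * (k : ℤ) ≤ 2 * n - wt d v + 2 * mult d (Pi.single i 1) + 2 * mult d (Pi.single i 1 + q)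
      - 2 * mult d q := by
  set e : Vec := Pi.single i 1 with he
  have hve : v ⬝ᵥ e = 1 := by simp [he, hv]
  have h1 := (h i).mul_le_sum (cover e q v) (by simp [cover]) (cover_add_le hve hq)
  have e0 : e ≠ 0 := by rintro h; rw [h] at hve; simp at hve
  have eq : e ≠ q := by rintro h; rw [h, hq] at hve; simp at hve
  have h2 : cover e q v e = 3 := by simp [cover, e0, eq]
  have h3 : ∀ j, (cover e q v (d j) : ℤ) = 2 - ind v (d j) + 2 * (if d j = e then 1 else 0)
      + 2 * (if d j = e + q then 1 else 0) - 2 * (if d j = q then 1 else 0) := fun j => by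
    unfold cover ind
    simp only [h0 j, false_or]
    by_cases j1 : d j = q
    · simp [j1, hq, eq.symm, e0]
    by_cases j2 : d j = e
    · simp [j2, eq, hve, hq0]
    by_cases j3 : d j = e + q
    · simp [j3, hq0, e0, dotProduct_add, hve, hq]
    · simp only [j1, j2, j3, or_self, if_false]; split_ifs <;> norm_num
  rw [← he, h2] at h1
  have h4 : ((k * 3 : ℕ) : ℤ) ≤ ∑ j, (cover e q v (d j) : ℤ) := by exact_mod_cast h1
  simp only [h3, Finset.sum_add_distrib, Finset.sum_sub_distrib, ← Finset.mul_sum] at h4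
  simp at h4
  unfold wt mult
  simp
  linarith

/-- The four-divisible mass function attached to a normalized PIR family. -/
theorem PIRFamily.exists_mass (hk : Even k) (h : PIRFamily d k) (h0 : ∀ j, d j ≠ 0)
    (hs : ∑ j, d j = 0) :
    ∃ δ F : Vec → ℤ, δ 0 = 0 ∧ (∀ v, 0 ≤ δ v) ∧ (∀ q, mass δ q = 4 * F q) ∧
      (∀ i v, v i = 1 → δ v ≤ F (Pi.single i 1)) ∧
      (∀ i v q, v i = 1 → ind v q = 0 →
        δ v + F q ≤ F (Pi.single i 1) + F (Pi.single i 1 + q)) ∧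
      2 * ∑ v, δ v = 16 * n - 31 * k := by
  obtain ⟨δ, hδ⟩ : ∃ δ : Vec → ℤ, ∀ v, 2 * δ v = wt d v - k + if v = 0 then (k : ℤ) else 0 := by
    refine ⟨fun v => (wt d v - k + if v = 0 then (k : ℤ) else 0) / 2, fun v => ?_⟩
    have h1 := even_wt hs v
    have h2 : Even (k : ℤ) := by exact_mod_cast hk
    have h3 : Even (wt d v - k + if v = 0 then (k : ℤ) else 0) := by
      refine (h1.sub h2).add ?_
      split_ifs
      · exact h2
      · exact Even.zero
    exact Int.mul_ediv_cancel' h3.two_dvd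
  have hδ0 : δ 0 = 0 := by
    have h1 := hδ 0
    have h2 : wt d 0 = 0 := by simp [wt, ind_zero_left]
    rw [h2, if_pos rfl] at h1
    omega
  have hδ1 : ∀ v, v ≠ 0 → 2 * δ v = wt d v - k := fun v hv => by rw [hδ, if_neg hv, add_zero]
  have hn : ∀ v, 0 ≤ δ v := fun v => by
    rcases eq_or_ne v 0 with rfl | hv
    · exact hδ0.ge
    · have := h.le_wt hv
      have := hδ1 v hv
      omega
  -- Forced by `sum_wt_mul_ind` and `sum_ind`: 2 · `mass δ q` = 8n + 8 · `mult d q` - 16k for q ≠ 0.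
  let F : Vec → ℤ := fun q => if q = 0 then 0 else n + mult d q - 2 * k
  have hF0 : F 0 = 0 := if_pos rfl
  have hF1 : ∀ q, q ≠ 0 → F q = n + mult d q - 2 * k := fun q hq => if_neg hq
  have hF : ∀ q, mass δ q = 4 * F q := fun q => by
    rcases eq_or_ne q 0 with rfl | hq
    · simp [hF0, mass, ind_zero_right]
    · have h1 : 2 * mass δ q = ∑ v, (wt d v * ind v q - k * ind v q) := by
        rw [mass, Finset.mul_sum]
        refine Finset.sum_congr rfl fun v _ => ?_
        rcases eq_or_ne v 0 with rfl | hv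
        · simp [ind_zero_left]
        · rw [← mul_assoc, hδ1 v hv]; ring
      rw [Finset.sum_sub_distrib, sum_wt_mul_ind h0 hq, ← Finset.mul_sum] at h1
      simp only [fun v => ind_comm v q, sum_ind hq] at h1
      rw [hF1 q hq]
      linarith
  have hne : ∀ {v : Vec} {i : Fin 5}, v i = 1 → v ≠ 0 := by
    rintro v i hv rfl
    simp at hv
  have hse : ∀ i : Fin 5, (Pi.single i 1 : Vec) ≠ 0 := fun i => hne (i := i) (by simp)
  have hrec : ∀ i v, v i = 1 → δ v ≤ F (Pi.single i 1) := fun i v hv => by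
    have h1 := h.recovery h0 hv
    have h2 := hδ1 v (hne hv)
    rw [hF1 _ (hse i)]
    linarith
  refine ⟨δ, F, hδ0, hn, hF, hrec, fun i v q hv hq => ?_, ?_⟩
  · have hq' : v ⬝ᵥ q = 0 := (zmod_two_cases _).resolve_right fun h => by simp [ind, h] at hq
    rcases eq_or_ne q 0 with rfl | hq0
    · have h1 := hrec i v hv
      have h2 := weight_nonneg hn hF (Pi.single i 1)
      rw [add_zero, hF0]
      linarith
    · have h1 := h.recovery_quotient h0 hv hq' hq0
      have h2 := hδ1 v (hne hv)
      have h3 : (Pi.single i 1 : Vec) + q ≠ 0 := fun h3 => by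
        rw [add_eq_zero_iff_vec] at h3
        rw [← h3] at hq'
        simp [hv] at hq'
      rw [hF1 _ (hse i), hF1 _ h3, hF1 _ hq0]
      linarith
  · rw [Finset.mul_sum, Finset.sum_congr rfl fun v _ => hδ v, Finset.sum_add_distrib,
      Finset.sum_sub_distrib, sum_wt h0]
    simp
    ring

end Inequalities

/-! ### The lower bound for the length -/

theorem PIRFamily.exists_of_le {n m k : ℕ} {c : Fin n → Vec} (h : PIRFamily c k) (hnm : n ≤ m) :
    ∃ d : Fin m → Vec, PIRFamily d k :=
  ⟨fun j => if hj : j.1 < n then c ⟨j.1, hj⟩ else 0, fun i =>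
    (h i).map (Fin.castLEEmb hnm) fun j => by simp⟩

/-- The lower bound for the length of a PIR code of dimension five, in terms of the total mass of
the associated four-divisible mass function. -/
theorem PIRFamily.le_length {τ r m n : ℕ} (hr : Even r) (hr0 : 0 < r)
    (hD : ∀ D : ℤ, 0 ≤ D → 2 * D = 16 * (m - 1) - 31 * r → D = 6 ∨ D = 9 ∨ 10 ≤ D ∧ D ≤ 13)
    {c : Fin n → Vec} (h : PIRFamily c (16 * τ + r)) : 31 * τ + m ≤ n := by
  by_contra! hlt
  have hk : Even (16 * τ + r) := Even.add ⟨8 * τ, by ring⟩ hr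
  -- Padding to length exactly 31τ + m - 1 fixes D, which no longer depends on τ.
  obtain ⟨c', hc'⟩ := h.exists_of_le (Nat.le_sub_one_of_lt hlt)
  obtain ⟨d, hd, d0, ds⟩ := hc'.exists_normalized hk (by omega)
  obtain ⟨δ, F, h0, hn, hF, h1, h2, hsum⟩ := hd.exists_mass hk d0 ds
  have hmn : ((31 * τ + m - 1 : ℕ) : ℤ) = 31 * τ + m - 1 := by
    rw [Nat.cast_sub (by omega)]; push_cast; ring
  rw [hmn] at hsum
  push_cast at hsum
  rcases hD (∑ v, δ v) (Finset.sum_nonneg fun v _ => hn v) (by rw [hsum]; ring) with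
    h6 | h9 | ⟨h10, h13⟩
  · exact sum_ne_six h0 hn hF h1 h6
  · exact sum_ne_nine h0 hn hF h1 h9
  · exact false_of_sum_mem_Icc h0 hn hF h1 h2 h10 h13

/-! ### Explicit codes -/

/-- The vector of binary digits of a natural number. -/
def digits (a : ℕ) : Vec := fun i => if a.testBit i then 1 else 0

theorem digits_xor (a b : ℕ) : digits (a ^^^ b) = digits a + digits b := by
  funext i
  simp only [digits, Nat.testBit_xor, Pi.add_apply]
  cases a.testBit i <;> cases b.testBit i <;> decide

theorem sum_map_digits (l : List ℕ) : (l.map digits).sum = digits (l.foldr (· ^^^ ·) 0) := by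
  induction l with
  | nil => funext i; simp [digits]
  | cons a l ih => rw [List.map_cons, List.sum_cons, ih, List.foldr_cons, digits_xor]

theorem digits_two_pow (i : Fin 5) : digits (2 ^ i.1) = Pi.single i 1 := by
  revert i; decide

/-- Disjoint lists without repetitions, each with bitwise sum `e`, form a packing. -/
theorem packing_of_lists {X : Finset ℕ} {L : List (List ℕ)} {e : ℕ} (hnd : L.flatten.Nodup)
    (hX : ∀ a ∈ L.flatten, a ∈ X) (hL : ∀ l ∈ L, l.foldr (· ^^^ ·) 0 = e) :
    Packing (fun a : X => digits a) L.length (digits e) := by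
  rw [List.nodup_flatten] at hnd
  refine ⟨fun j => (L.get j).toFinset.subtype (· ∈ X), fun j j' hj => ?_, fun j => ?_⟩
  · have hdis : List.Disjoint (L.get j) (L.get j') := by
      have := List.pairwise_iff_get.1 hnd.2
      rcases lt_or_gt_of_ne hj with h | h
      · exact this _ _ h
      · exact (this _ _ h).symm
    rw [Finset.disjoint_left]
    intro a ha hb
    rw [Finset.mem_subtype, List.mem_toFinset] at ha hb
    exact hdis ha hb
  · have hmem : L.get j ∈ L := List.get_mem L j
    rw [Finset.sum_subtype_of_mem digits fun a ha =>
        hX a (List.mem_flatten.2 ⟨_, hmem, List.mem_toFinset.1 ha⟩),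
      List.sum_toFinset _ (hnd.1 _ hmem), sum_map_digits, hL _ hmem]

theorem exists_family_of_lists (n k : ℕ) (X : List ℕ) (T : Fin 5 → List (List ℕ))
    (h : X.toFinset.card = n ∧ ∀ i, (T i).length = k ∧ (T i).flatten.Nodup ∧
      (∀ a ∈ (T i).flatten, a ∈ X) ∧ ∀ l ∈ T i, l.foldr (· ^^^ ·) 0 = 2 ^ i.1) :
    ∃ c : Fin n → Vec, PIRFamily c k := by
  refine PIRFamily.exists_fin (c := fun a : X.toFinset => digits a) (fun i => ?_)
    ((Fintype.card_coe _).trans h.1)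
  obtain ⟨h1, h2, h3, h4⟩ := h.2 i
  rw [← h1, ← digits_two_pow]
  exact packing_of_lists h2 (fun a ha => List.mem_toFinset.2 (h3 a ha)) h4

theorem exists_family_two : ∃ c : Fin 6 → Vec, PIRFamily c 2 :=
  exists_family_of_lists 6 2
    [1, 2, 4, 8, 16, 31]
    ![
      [[1], [2, 4, 8, 16, 31]],
      [[2], [1, 4, 8, 16, 31]],
      [[4], [1, 2, 8, 16, 31]],
      [[8], [1, 2, 4, 16, 31]],
      [[16], [1, 2, 4, 8, 31]]]
    (by decide)

theorem exists_family_four : ∃ c : Fin 10 → Vec, PIRFamily c 4 :=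
  exists_family_of_lists 10 4
    [1, 2, 4, 8, 16, 21, 22, 25, 27, 30]
    ![
      [[1], [2, 21, 22], [4, 27, 30], [8, 16, 25]],
      [[2], [25, 27], [1, 21, 22], [4, 8, 16, 30]],
      [[4], [1, 27, 30], [2, 16, 22], [8, 21, 25]],
      [[8], [22, 30], [1, 16, 25], [2, 4, 21, 27]],
      [[16], [1, 8, 25], [2, 4, 22], [21, 27, 30]]]
    (by decide)

theorem exists_family_six : ∃ c : Fin 14 → Vec, PIRFamily c 6 :=
  exists_family_of_lists 14 6
    [1, 2, 4, 5, 6, 8, 10, 13, 16, 19, 20, 26, 27, 29]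
    ![
      [[1], [4, 5], [26, 27], [2, 16, 19], [6, 10, 13], [8, 20, 29]],
      [[2], [4, 6], [8, 10], [1, 16, 19], [5, 26, 29], [13, 20, 27]],
      [[4], [1, 5], [2, 6], [16, 20], [10, 19, 29], [8, 13, 26, 27]],
      [[8], [2, 10], [5, 13], [19, 27], [6, 20, 26], [1, 4, 16, 29]],
      [[16], [4, 20], [10, 26], [13, 29], [1, 2, 19], [5, 6, 8, 27]]]
    (by decide)

theorem exists_family_eight : ∃ c : Fin 18 → Vec, PIRFamily c 8 :=
  exists_family_of_lists 18 8
    [1, 3, 7, 8, 9, 12, 13, 15, 16, 18, 19, 21, 23, 24, 25, 26, 28, 30]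
    ![
      [[1], [8, 9], [12, 13], [18, 19], [24, 25], [3, 21, 23], [7, 26, 28], [15, 16, 30]],
      [[1, 3], [13, 15], [16, 18], [21, 23], [24, 26], [28, 30], [7, 9, 12], [8, 19, 25]],
      [[3, 7], [8, 12], [9, 13], [19, 23], [24, 28], [26, 30], [1, 16, 21], [15, 18, 25]],
      [[8], [1, 9], [7, 15], [16, 24], [18, 26], [3, 21, 30], [12, 19, 23], [13, 25, 28]],
      [[16], [3, 19], [7, 23], [8, 24], [9, 25], [12, 28], [1, 15, 30], [13, 18, 21, 26]]]
    (by decide)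

theorem exists_family_ten : ∃ c : Fin 22 → Vec, PIRFamily c 10 :=
  exists_family_of_lists 22 10
    [1, 2, 4, 5, 6, 8, 9, 10, 11, 12, 13, 14, 17, 18, 19, 21, 22, 24, 26, 27, 28, 29]
    ![
      [[1], [4, 5], [8, 9], [10, 11], [12, 13], [18, 19], [26, 27], [28, 29], [6, 17, 22], [2,
       14, 21, 24]],
      [[2], [4, 6], [8, 10], [9, 11], [12, 14], [17, 19], [24, 26], [1, 21, 22], [5, 27, 28],
       [13, 18, 29]],
      [[4], [1, 5], [2, 6], [8, 12], [9, 13], [10, 14], [17, 21], [18, 22], [24, 28], [11, 19,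
       26, 27, 29]],
      [[8], [1, 9], [2, 10], [4, 12], [5, 13], [6, 14], [18, 26], [19, 27], [21, 29], [11, 17,
       22, 24, 28]],
      [[1, 17], [2, 18], [5, 21], [6, 22], [8, 24], [10, 26], [11, 27], [12, 28], [13, 29], [4,
       9, 14, 19]]]
    (by decide)

theorem exists_family_twelve : ∃ c : Fin 25 → Vec, PIRFamily c 12 :=
  exists_family_of_lists 25 12
    [2, 4, 5, 6, 7, 10, 11, 12, 13, 14, 15, 16, 17, 18, 19, 20, 21, 22, 23, 24, 25, 26, 27, 28,
     31]
    ![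
      [[4, 5], [6, 7], [10, 11], [12, 13], [14, 15], [16, 17], [18, 19], [20, 21], [22, 23], [24,
       25], [26, 27], [2, 28, 31]],
      [[2], [4, 6], [5, 7], [12, 14], [13, 15], [16, 18], [17, 19], [20, 22], [21, 23], [24, 26],
       [25, 27], [10, 11, 28, 31]],
      [[4], [2, 6], [10, 14], [11, 15], [16, 20], [17, 21], [18, 22], [19, 23], [24, 28], [27,
       31], [5, 12, 13], [7, 25, 26]],
      [[2, 10], [4, 12], [5, 13], [6, 14], [7, 15], [16, 24], [17, 25], [18, 26], [19, 27], [20,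
       28], [23, 31], [11, 21, 22]],
      [[16], [2, 18], [4, 20], [5, 21], [6, 22], [7, 23], [10, 26], [11, 27], [12, 28], [15, 31],
       [13, 14, 19], [17, 24, 25]]]
    (by decide)

theorem exists_family_fourteen : ∃ c : Fin 28 → Vec, PIRFamily c 14 :=
  exists_family_of_lists 28 14
    [1, 2, 3, 5, 6, 7, 9, 10, 11, 13, 14, 15, 16, 17, 18, 19, 20, 21, 22, 23, 24, 25, 26, 27, 28,
     29, 30, 31]
    ![
      [[1], [2, 3], [6, 7], [10, 11], [14, 15], [16, 17], [18, 19], [20, 21], [22, 23], [24, 25],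
       [26, 27], [28, 29], [30, 31], [5, 9, 13]],
      [[2], [1, 3], [5, 7], [9, 11], [13, 15], [16, 18], [17, 19], [20, 22], [21, 23], [24, 26],
       [25, 27], [28, 30], [29, 31], [6, 10, 14]],
      [[1, 5], [2, 6], [3, 7], [9, 13], [10, 14], [11, 15], [16, 20], [17, 21], [18, 22], [19,
       23], [24, 28], [25, 29], [26, 30], [27, 31]],
      [[1, 9], [2, 10], [3, 11], [5, 13], [6, 14], [7, 15], [16, 24], [17, 25], [18, 26], [19,
       27], [20, 28], [21, 29], [22, 30], [23, 31]],
      [[16], [1, 17], [2, 18], [3, 19], [5, 21], [6, 22], [7, 23], [9, 25], [10, 26], [11, 27],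
       [13, 29], [14, 30], [15, 31], [20, 24, 28]]]
    (by decide)

/-- The simplex code: e_i is recovered by itself and by the 15 pairs {v, v + e_i}. -/
theorem exists_family_sixteen : ∃ c : Fin 31 → Vec, PIRFamily c 16 :=
  exists_family_of_lists 31 16
    (List.range 32).tail
    ![
      [[1], [2, 3], [4, 5], [6, 7], [8, 9], [10, 11], [12, 13], [14, 15], [16, 17], [18, 19],
       [20, 21], [22, 23], [24, 25], [26, 27], [28, 29], [30, 31]],
      [[2], [1, 3], [4, 6], [5, 7], [8, 10], [9, 11], [12, 14], [13, 15], [16, 18], [17, 19],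
       [20, 22], [21, 23], [24, 26], [25, 27], [28, 30], [29, 31]],
      [[4], [1, 5], [2, 6], [3, 7], [8, 12], [9, 13], [10, 14], [11, 15], [16, 20], [17, 21],
       [18, 22], [19, 23], [24, 28], [25, 29], [26, 30], [27, 31]],
      [[8], [1, 9], [2, 10], [3, 11], [4, 12], [5, 13], [6, 14], [7, 15], [16, 24], [17, 25],
       [18, 26], [19, 27], [20, 28], [21, 29], [22, 30], [23, 31]],
      [[16], [1, 17], [2, 18], [3, 19], [4, 20], [5, 21], [6, 22], [7, 23], [8, 24], [9, 25],
       [10, 26], [11, 27], [12, 28], [13, 29], [14, 30], [15, 31]]]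
    (by decide)

/-! ### Simplex extensions and the values of P(5, k) -/

theorem PIRFamily.add_simplex {m r : ℕ} (h : ∃ c : Fin m → Vec, PIRFamily c r) (τ : ℕ) :
    ∃ c : Fin (31 * τ + m) → Vec, PIRFamily c (16 * τ + r) := by
  induction τ with
  | zero => rwa [mul_zero, mul_zero, zero_add, zero_add]
  | succ τ ih =>
    obtain ⟨c, hc⟩ := ih
    obtain ⟨d, hd⟩ := exists_family_sixteen
    rw [show 16 * (τ + 1) + r = 16 * τ + r + 16 by ring]
    exact PIRFamily.exists_fin (fun i => (hc i).sumElim (hd i)) (by simp; ring)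

theorem P_five_eq {m r : ℕ} (hr : Even r) (hr0 : 0 < r)
    (hD : ∀ D : ℤ, 0 ≤ D → 2 * D = 16 * (m - 1) - 31 * r → D = 6 ∨ D = 9 ∨ 10 ≤ D ∧ D ≤ 13)
    (h : ∃ c : Fin m → Vec, PIRFamily c r) (τ : ℕ) : P 5 (16 * τ + r) = 31 * τ + m := by
  refine IsLeast.csInf_eq ⟨?_, fun n hn => ?_⟩
  · exact (exists_isPIRCode_iff (by omega)).2 (PIRFamily.add_simplex h τ)
  · obtain ⟨c, hc⟩ := (exists_isPIRCode_iff (by omega)).1 hn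
    exact hc.le_length hr hr0 hD

theorem P_five_two (τ : ℕ) : P 5 (16 * τ + 2) = 31 * τ + 6 :=
  P_five_eq (by decide) (by norm_num) (fun D _ _ => by push_cast at *; omega)
    exists_family_two τ

theorem P_five_four (τ : ℕ) : P 5 (16 * τ + 4) = 31 * τ + 10 :=
  P_five_eq (by decide) (by norm_num) (fun D _ _ => by push_cast at *; omega)
    exists_family_four τ

theorem P_five_six (τ : ℕ) : P 5 (16 * τ + 6) = 31 * τ + 14 :=
  P_five_eq (by decide) (by norm_num) (fun D _ _ => by push_cast at *; omega)
    exists_family_six τ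

theorem P_five_eight (τ : ℕ) : P 5 (16 * τ + 8) = 31 * τ + 18 :=
  P_five_eq (by decide) (by norm_num) (fun D _ _ => by push_cast at *; omega)
    exists_family_eight τ

theorem P_five_ten (τ : ℕ) : P 5 (16 * τ + 10) = 31 * τ + 22 :=
  P_five_eq (by decide) (by norm_num) (fun D _ _ => by push_cast at *; omega)
    exists_family_ten τ

theorem P_five_twelve (τ : ℕ) : P 5 (16 * τ + 12) = 31 * τ + 25 :=
  P_five_eq (by decide) (by norm_num) (fun D _ _ => by push_cast at *; omega)
    exists_family_twelve τ

theorem P_five_fourteen (τ : ℕ) : P 5 (16 * τ + 14) = 31 * τ + 28 :=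
  P_five_eq (by decide) (by norm_num) (fun D _ _ => by push_cast at *; omega)
    exists_family_fourteen τ

theorem P_five_sixteen (τ : ℕ) : P 5 (16 * τ + 16) = 31 * τ + 31 :=
  P_five_eq (by decide) (by norm_num) (fun D _ _ => by push_cast at *; omega)
    exists_family_sixteen τ

end PIR

theorem mainTheorem2 :
    PIR.P 5 2 = 6 ∧ PIR.P 5 4 = 10 ∧ PIR.P 5 6 = 14 ∧ PIR.P 5 8 = 18 ∧
    PIR.P 5 10 = 22 ∧ PIR.P 5 12 = 25 ∧ PIR.P 5 14 = 28 ∧ PIR.P 5 16 = 31 ∧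
    ∀ k : ℕ, Even k → 16 < k →
      PIR.P 5 k = PIR.P 5 (k - 16 * ((k - 1) / 16)) + 31 * ((k - 1) / 16) := by
  refine ⟨PIR.P_five_two 0, PIR.P_five_four 0, PIR.P_five_six 0, PIR.P_five_eight 0,
    PIR.P_five_ten 0, PIR.P_five_twelve 0, PIR.P_five_fourteen 0, PIR.P_five_sixteen 0,
    fun k hk hk16 => ?_⟩
  obtain ⟨τ, r, hτ, hr0, hr16, rfl⟩ :
      ∃ τ r, (k - 1) / 16 = τ ∧ 0 < r ∧ r ≤ 16 ∧ k = 16 * τ + r :=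
    ⟨(k - 1) / 16, k - 16 * ((k - 1) / 16), rfl, by omega, by omega, by omega⟩
  rw [hτ, Nat.add_sub_cancel_left]
  have hr : r = 2 ∨ r = 4 ∨ r = 6 ∨ r = 8 ∨ r = 10 ∨ r = 12 ∨ r = 14 ∨ r = 16 := by
    obtain ⟨s, hs⟩ := hk
    omega
  rcases hr with rfl | rfl | rfl | rfl | rfl | rfl | rfl | rfl
  · rw [PIR.P_five_two τ, show PIR.P 5 2 = 6 from PIR.P_five_two 0, add_comm]
  · rw [PIR.P_five_four τ, show PIR.P 5 4 = 10 from PIR.P_five_four 0, add_comm]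
  · rw [PIR.P_five_six τ, show PIR.P 5 6 = 14 from PIR.P_five_six 0, add_comm]
  · rw [PIR.P_five_eight τ, show PIR.P 5 8 = 18 from PIR.P_five_eight 0, add_comm]
  · rw [PIR.P_five_ten τ, show PIR.P 5 10 = 22 from PIR.P_five_ten 0, add_comm]
  · rw [PIR.P_five_twelve τ, show PIR.P 5 12 = 25 from PIR.P_five_twelve 0, add_comm]
  · rw [PIR.P_five_fourteen τ, show PIR.P 5 14 = 28 from PIR.P_five_fourteen 0, add_comm]
  · rw [PIR.P_five_sixteen τ, show PIR.P 5 16 = 31 from PIR.P_five_sixteen 0, add_comm]
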